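/- Let $X$ be a non-empty set and let $Z=(Z(x))_{x\in X}$ be a real-valued stochastic process on a probability space with $\mathbb{E}[Z(x)^2]<\infty$ for all $x\in X$. Put $d(x_1,x_2)=\operatorname{Var}(Z(x_1)-Z(x_2))$ for $x_1,x_2\in X$ (the variogram of $Z$). Let $\psi:[0,\infty)\to\mathbb{R}$ be a non-constant completely monotone function, that is, $\psi$ is continuous on $[0,\infty)$, infinitely differentiable on $(0,\infty)$, and $(-1)^i\psi^{(i)}(x)\ge 0$ for all integers $i\ge 0$ and all $x>0$. Then: 1. there exist a real Hilbert space $H$ and a map $\xi:X\to H$ such that $\sqrt{d(x_1,x_2)}=\|\xi(x_1)-\xi(x_2)\|_H$ for all $x_1,x_2\in X$ (that is, $(X,d)$ has a $\sqrt{\cdot}$-embedding into $H$); 2. the function $(x_1,x_2)\mapsto\psi(d(x_1,x_2))$ is positive semidefinite, that is, $\sum_{i=1}^n\sum_{j=1}^n a_ia_j\,\psi(d(x_i,x_j))\ge 0$ for all $n\ge 1$, $x_1,\dots,x_n\in X$ and $a_1,\dots,a_n\in\mathbb{R}$; 3. if, in addition, $d$ is a semi-metric on $X$ (that is, for all $x,y\in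 X$: $d(x,y)\ge 0$, $d(x,y)=d(y,x)$, and $d(x,y)=0$ if and only if $x=y$), then $(x_1,x_2)\mapsto\psi(d(x_1,x_2))$ is strictly positive definite, that is, it is positive semidefinite and, for pairwise distinct points $x_1,\dots,x_n\in X$, equality in the inequality of part 2 holds only if $a_1=\dots=a_n=0$. -/

import Mathlib

universe u v

open MeasureTheory ProbabilityTheory

/-- A real function `k` of two variables on `X` is positive semidefinite if
`∑ i, ∑ j, a i * a j * k (x i) (x j) ≥ 0` for all finite families of points `x i` and reals `a i`. -/
def IsPosSemidefFun {X : Type*} (k : X → X → ℝ) : Prop :=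
  ∀ (n : ℕ) (x : Fin n → X) (a : Fin n → ℝ), 0 ≤ ∑ i, ∑ j, a i * a j * k (x i) (x j)

/-- A positive semidefinite function is strictly positive definite if, for pairwise distinct
points `x i`, the quadratic form vanishes only when all the coefficients vanish. -/
def IsStrictPosDefFun {X : Type*} (k : X → X → ℝ) : Prop :=
  IsPosSemidefFun k ∧
    ∀ (n : ℕ) (x : Fin n → X), Function.Injective x → ∀ a : Fin n → ℝ,
      ∑ i, ∑ j, a i * a j * k (x i) (x j) = 0 → ∀ i, a i = 0

/-- `d` is a semi-metric on `X`: a metric without the triangle inequality. -/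
structure IsSemiMetric {X : Type*} (d : X → X → ℝ) : Prop where
  nonneg : ∀ x y, 0 ≤ d x y
  eq_zero_iff : ∀ x y, d x y = 0 ↔ x = y
  symm : ∀ x y, d x y = d y x

/-- `ψ` is completely monotone on `[0, ∞)`: continuous on `[0, ∞)`, infinitely differentiable on
`(0, ∞)`, with `(-1) ^ i * ψ⁽ⁱ⁾ ≥ 0` on `(0, ∞)` for all `i ≥ 0`. Only the values of `ψ` on
`[0, ∞)` matter, since each derivative is taken at a point of the open half-line. -/
structure IsCompletelyMonotone (ψ : ℝ → ℝ) : Prop where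
  continuousOn : ContinuousOn ψ (Set.Ici 0)
  contDiffOn : ContDiffOn ℝ (⊤ : ℕ∞) ψ (Set.Ioi 0)
  alternating : ∀ (i : ℕ) (x : ℝ), 0 < x → 0 ≤ (-1) ^ i * iteratedDeriv i ψ x

/-- The variogram `(x₁, x₂) ↦ Var (Z x₁ - Z x₂)` of a real-valued process `Z` indexed by `X`. -/
noncomputable def variogram {X Ω : Type*} [MeasurableSpace Ω] (P : Measure Ω) (Z : X → Ω → ℝ)
    (x₁ x₂ : X) : ℝ :=
  variance (fun ω => Z x₁ ω - Z x₂ ω) P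

/-- `(X, d)` has a `g`-embedding into the normed space `H`. -/
def HasEmbedding {X : Type*} (g : ℝ → ℝ) (d : X → X → ℝ) (H : Type*) [NormedAddCommGroup H] :
    Prop :=
  ∃ ξ : X → H, ∀ x₁ x₂, g (d x₁ x₂) = ‖ξ x₁ - ξ x₂‖

/-! Centring $Z$ embeds $d$ into $L^2$ as a squared distance, so exponentials of $-s\,d$ are
Gaussian kernels. Bernstein's integral representation is bypassed by a transfer principle,
`IsCompletelyMonotone.sum_nonneg`: a finite combination of $e^{-st}$ that is nonnegative for every
$s\ge 0$ stays nonnegative with $\psi(t)$ in place of $e^{-st}$. Indeed, the Taylor series of $\psi$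
at $u^{-1}+u$, evaluated at $(1-e^{-ut})/u+u$, is a series in $e^{-nut}$ with nonnegative
coefficients, and its argument tends to $t$ as $u\to 0^+$.

For strictness, let $Q(s)>0$ be the Gaussian form. For each $\delta>0$ some $K$ gives
$|e^{-sp}-e^{-sq}|\le\delta+KQ(s)$. If the $\psi$-form vanishes, transfer yields
$|\psi(p)-\psi(q)|\le\delta\psi(0)$ for all $p,q>0$, so $\psi$ is constant. -/

open Filter Topology

/-! ### Taylor series of functions with alternating derivatives -/

/-- The Taylor expansion of a smooth function on the open half-line, with Cauchy remainder,
evaluated to the left of the centre. -/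
theorem exists_taylor_cauchy_left {f : ℝ → ℝ} (hf : ContDiffOn ℝ (⊤ : ℕ∞) f (Set.Ioi 0))
    {x x₀ : ℝ} (hx : 0 < x) (hxx : x < x₀) (n : ℕ) :
    ∃ y ∈ Set.Ioo x x₀, f x =
      ∑ k ∈ Finset.range (n + 1),
        (-1) ^ k * iteratedDeriv k f x₀ / k.factorial * (x₀ - x) ^ k +
      (-1) ^ (n + 1) * iteratedDeriv (n + 1) f y * (y - x) ^ n / n.factorial * (x₀ - x) := by
  have hu : Set.uIcc x₀ x = Set.Icc x x₀ := Set.uIcc_of_ge hxx.le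
  have hu' : Set.uIoo x₀ x = Set.Ioo x x₀ := Set.uIoo_of_ge hxx.le
  have hsub : Set.Icc x x₀ ⊆ Set.Ioi 0 := fun y hy => lt_of_lt_of_le hx hy.1
  have hat : ∀ y ∈ Set.Icc x x₀, ContDiffAt ℝ (⊤ : ℕ∞) f y := fun y hy =>
    hf.contDiffAt (Ioi_mem_nhds (hsub hy))
  have heq : ∀ (k : ℕ), ∀ y ∈ Set.Icc x x₀,
      iteratedDerivWithin k f (Set.Icc x x₀) y = iteratedDeriv k f y := fun k y hy =>
    iteratedDerivWithin_eq_iteratedDeriv (uniqueDiffOn_Icc hxx)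
      ((hat y hy).of_le (by exact_mod_cast le_top)) hy
  have hd : DifferentiableOn ℝ (iteratedDerivWithin n f (Set.Icc x x₀)) (Set.Icc x x₀) :=
    (hf.mono hsub).differentiableOn_iteratedDerivWithin
      (by exact_mod_cast WithTop.coe_lt_top n) (uniqueDiffOn_Icc hxx)
  obtain ⟨y, hy, h⟩ := taylor_mean_remainder_cauchy (f := f) (n := n) hxx.ne'
    (by rw [hu]; exact (hf.mono hsub).of_le (by exact_mod_cast le_top))
    (by rw [hu, hu']; exact hd.mono Set.Ioo_subset_Icc_self)
  rw [hu'] at hy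
  rw [hu, taylor_within_apply, heq _ y (Set.Ioo_subset_Icc_self hy), sub_eq_iff_eq_add'] at h
  refine ⟨y, hy, h.trans ?_⟩
  congr 1
  · refine Finset.sum_congr rfl fun k _ => ?_
    rw [heq k x₀ (Set.right_mem_Icc.2 hxx.le), smul_eq_mul, ← neg_sub x₀ x, neg_pow (x₀ - x) k]
    ring
  · rw [← neg_sub y x, ← neg_sub x₀ x, neg_pow (y - x) n, pow_succ]
    ring

/-- Each term of the Taylor expansion of a function with alternating derivatives is bounded by
the value of the function. -/
theorem taylor_term_le_of_alternating {f : ℝ → ℝ}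
    (hf : ContDiffOn ℝ (⊤ : ℕ∞) f (Set.Ioi 0))
    (hf' : ∀ (i : ℕ) (x : ℝ), 0 < x → 0 ≤ (-1) ^ i * iteratedDeriv i f x)
    {x x₀ : ℝ} (hx : 0 < x) (hxx : x < x₀) (n : ℕ) :
    (-1) ^ n * iteratedDeriv n f x₀ / n.factorial * (x₀ - x) ^ n ≤ f x := by
  obtain ⟨y, hy, h⟩ := exists_taylor_cauchy_left hf hx hxx n
  have hx₀ : 0 < x₀ - x := sub_pos.2 hxx
  have hyx : 0 < y - x := sub_pos.2 hy.1
  have h1 : (-1) ^ n * iteratedDeriv n f x₀ / n.factorial * (x₀ - x) ^ n ≤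
      ∑ k ∈ Finset.range (n + 1), (-1) ^ k * iteratedDeriv k f x₀ / k.factorial * (x₀ - x) ^ k :=
    Finset.single_le_sum
      (f := fun k : ℕ => (-1) ^ k * iteratedDeriv k f x₀ / k.factorial * (x₀ - x) ^ k)
      (fun k _ => mul_nonneg (div_nonneg (hf' k x₀ (hx.trans hxx)) (by positivity)) (by positivity))
      (Finset.self_mem_range_succ n)
  have h2 : 0 ≤ (-1) ^ (n + 1) * iteratedDeriv (n + 1) f y * (y - x) ^ n / n.factorial *
      (x₀ - x) :=
    mul_nonneg (div_nonneg (mul_nonneg (hf' (n + 1) y (hx.trans hy.1)) (by positivity))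
      (by positivity)) hx₀.le
  linarith

/-- A function with alternating derivatives on the open half-line is the sum of its Taylor series
to the left of the centre. -/
theorem hasSum_taylor_of_alternating {f : ℝ → ℝ}
    (hf : ContDiffOn ℝ (⊤ : ℕ∞) f (Set.Ioi 0))
    (hf' : ∀ (i : ℕ) (x : ℝ), 0 < x → 0 ≤ (-1) ^ i * iteratedDeriv i f x)
    {x x₀ : ℝ} (hx : 0 < x) (hxx : x < x₀) :
    HasSum (fun n : ℕ => (-1) ^ n * iteratedDeriv n f x₀ / n.factorial * (x₀ - x) ^ n) (f x) := by
  have hx₀ : 0 < x₀ - x := sub_pos.2 hxx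
  have hnn : ∀ k : ℕ, 0 ≤ (-1) ^ k * iteratedDeriv k f x₀ / k.factorial * (x₀ - x) ^ k := fun k =>
    mul_nonneg (div_nonneg (hf' k x₀ (hx.trans hxx)) (by positivity)) (by positivity)
  rw [hasSum_iff_tendsto_nat_of_nonneg hnn, ← tendsto_add_atTop_iff_nat 1]
  -- The remainder is a Taylor term of $-f'$, taken from $y$ to a point $b<x$ and hence at most `g
  -- b`, times a factor that decays geometrically.
  set g : ℝ → ℝ := fun z => -deriv f z with hg_def
  have hgi : ∀ (i : ℕ) (z : ℝ), iteratedDeriv i g z = -iteratedDeriv (i + 1) f z := fun i z => by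
    rw [hg_def, iteratedDeriv_fun_neg, iteratedDeriv_succ']
  have hg : ContDiffOn ℝ (⊤ : ℕ∞) g (Set.Ioi 0) :=
    (hf.deriv_of_isOpen isOpen_Ioi (by simp)).neg
  have hg' : ∀ (i : ℕ) (z : ℝ), 0 < z → 0 ≤ (-1) ^ i * iteratedDeriv i g z := fun i z hz => by
    have := hf' (i + 1) z hz
    rw [hgi]
    rw [pow_succ] at this
    linarith
  set b := x / 2
  have hb : 0 < b := half_pos hx
  have hbx : b < x := half_lt_self hx
  set r := (x₀ - x) / (x₀ - b)
  have hr0 : 0 ≤ r := div_nonneg hx₀.le (by linarith)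
  have hr1 : r < 1 := (div_lt_one (by linarith)).2 (by linarith)
  have hlim : Tendsto (fun n : ℕ => f x - g b * (x₀ - x) * r ^ n) atTop (𝓝 (f x)) := by
    simpa using (tendsto_pow_atTop_nhds_zero_of_lt_one hr0 hr1).const_mul (g b * (x₀ - x))
      |>.const_sub (f x)
  refine tendsto_of_tendsto_of_tendsto_of_le_of_le hlim tendsto_const_nhds (fun n => ?_)
    (fun n => ?_)
  · obtain ⟨y, hy, h⟩ := exists_taylor_cauchy_left hf hx hxx n
    have hby : b < y := hbx.trans hy.1
    have hyb : 0 < y - b := sub_pos.2 hby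
    have hyx : 0 < y - x := sub_pos.2 hy.1
    have hterm := taylor_term_le_of_alternating hg hg' hb hby n
    have hratio : (y - x) / (y - b) ≤ r := by
      rw [div_le_div_iff₀ hyb (by linarith)]
      nlinarith [hy.2]
    have hpow : ((y - x) / (y - b)) ^ n ≤ r ^ n :=
      pow_le_pow_left₀ (div_nonneg hyx.le hyb.le) hratio n
    have hrem : (-1) ^ (n + 1) * iteratedDeriv (n + 1) f y * (y - x) ^ n / n.factorial * (x₀ - x) =
        ((-1) ^ n * iteratedDeriv n g y / n.factorial * (y - b) ^ n) *
          ((y - x) / (y - b)) ^ n * (x₀ - x) := by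
      rw [hgi, div_pow]
      field_simp
      ring
    have hgb : 0 ≤ g b := by simpa using hg' 0 b hb
    have hle : ((-1) ^ n * iteratedDeriv n g y / n.factorial * (y - b) ^ n) *
          ((y - x) / (y - b)) ^ n * (x₀ - x) ≤ g b * r ^ n * (x₀ - x) := by
      gcongr
    simp only
    linarith
  · obtain ⟨y, hy, h⟩ := exists_taylor_cauchy_left hf hx hxx n
    have hyx : 0 < y - x := sub_pos.2 hy.1
    have h2 : 0 ≤ (-1) ^ (n + 1) * iteratedDeriv (n + 1) f y * (y - x) ^ n / n.factorial *
        (x₀ - x) :=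
      mul_nonneg (div_nonneg (mul_nonneg (hf' (n + 1) y (hx.trans hy.1)) (by positivity))
        (by positivity)) hx₀.le
    simp only
    linarith

/-! ### Transfer from exponentials to completely monotone functions -/

/-- The summand `u` keeps the argument in the open half-line even when `t = 0`. -/
theorem tendsto_one_sub_exp_div (t : ℝ) :
    Tendsto (fun u : ℝ => (1 - Real.exp (-(u * t))) / u + u) (𝓝[>] 0) (𝓝 t) := by
  have h : HasDerivAt (fun u : ℝ => 1 - Real.exp (-(u * t))) t 0 := by
    simpa using (((hasDerivAt_id (0 : ℝ)).mul_const t).neg.exp).const_sub 1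
  have h1 := h.tendsto_slope_zero_right
  have h2 : Tendsto (fun u : ℝ => u) (𝓝[>] 0) (𝓝 0) := nhdsWithin_le_nhds
  refine (by simpa using h1.add h2 : Tendsto _ _ (𝓝 t)).congr fun u => ?_
  simp [div_eq_inv_mul]

/-- A finite combination of exponentials that is nonnegative at all rates stays nonnegative when
the exponential is replaced by a completely monotone function. -/
theorem IsCompletelyMonotone.sum_nonneg {ψ : ℝ → ℝ} (hψ : IsCompletelyMonotone ψ)
    {ι : Type*} [Fintype ι] (c t : ι → ℝ) (ht : ∀ k, 0 ≤ t k)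
    (h : ∀ s : ℝ, 0 ≤ s → 0 ≤ ∑ k, c k * Real.exp (-(s * t k))) :
    0 ≤ ∑ k, c k * ψ (t k) := by
  have hpos : ∀ u > (0 : ℝ), ∀ r : ℝ, 0 ≤ r → 0 < (1 - Real.exp (-(u * r))) / u + u := by
    intro u hu r hr
    have : Real.exp (-(u * r)) ≤ 1 := Real.exp_le_one_iff.2 (neg_nonpos.2 (by positivity))
    have : 0 ≤ (1 - Real.exp (-(u * r))) / u := div_nonneg (by linarith) hu.le
    linarith
  have hlim : Tendsto (fun u : ℝ => ∑ k, c k * ψ ((1 - Real.exp (-(u * t k))) / u + u)) (𝓝[>] 0)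
      (𝓝 (∑ k, c k * ψ (t k))) := by
    refine tendsto_finsetSum _ fun k _ => Tendsto.const_mul _ ?_
    refine (hψ.continuousOn (t k) (ht k)).tendsto.comp
      (tendsto_nhdsWithin_iff.2 ⟨tendsto_one_sub_exp_div (t k), ?_⟩)
    filter_upwards [self_mem_nhdsWithin] with u hu using (hpos u hu _ (ht k)).le
  refine ge_of_tendsto hlim ?_
  filter_upwards [self_mem_nhdsWithin] with u (hu : 0 < u)
  -- With this centre the increment is exactly $u^{-1}e^{-ut}$, whose powers are again exponentials
  -- in $t$.
  set x₀ := u⁻¹ + u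
  have hsum : HasSum (fun n : ℕ => ∑ k, c k * ((-1) ^ n * iteratedDeriv n ψ x₀ / n.factorial *
      (x₀ - ((1 - Real.exp (-(u * t k))) / u + u)) ^ n))
      (∑ k, c k * ψ ((1 - Real.exp (-(u * t k))) / u + u)) := by
    refine hasSum_sum fun k _ => HasSum.mul_left _ ?_
    refine hasSum_taylor_of_alternating hψ.contDiffOn hψ.alternating (hpos u hu _ (ht k)) ?_
    have := div_pos (Real.exp_pos (-(u * t k))) hu
    simp only [x₀, sub_div, one_div]
    linarith
  refine hsum.nonneg fun n => ?_
  have heq : ∀ k, (x₀ - ((1 - Real.exp (-(u * t k))) / u + u)) ^ n =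
      u⁻¹ ^ n * Real.exp (-((n * u) * t k)) := fun k => by
    have : x₀ - ((1 - Real.exp (-(u * t k))) / u + u) = u⁻¹ * Real.exp (-(u * t k)) := by
      simp only [x₀]
      field_simp
      ring
    rw [this, mul_pow, ← Real.exp_nat_mul]
    congr 2
    ring
  have hx₀ : 0 < x₀ := by positivity
  calc (0 : ℝ) ≤ ((-1) ^ n * iteratedDeriv n ψ x₀ / n.factorial * u⁻¹ ^ n) *
        ∑ k, c k * Real.exp (-((n * u) * t k)) :=
        mul_nonneg (mul_nonneg (div_nonneg (hψ.alternating n x₀ hx₀) (by positivity))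
          (by positivity)) (h _ (by positivity))
    _ = _ := by
        rw [Finset.mul_sum]
        refine Finset.sum_congr rfl fun k _ => ?_
        rw [heq]
        ring

/-! ### Exponential and Gaussian kernels -/

section Gaussian

variable {H : Type*} [NormedAddCommGroup H] [InnerProductSpace ℝ H]

/-- Schur product theorem, applied to Hadamard powers of a Gram matrix. -/
theorem sum_mul_inner_pow_nonneg {n : ℕ} (x : Fin n → H) (b : Fin n → ℝ) (m : ℕ) :
    0 ≤ ∑ i, ∑ j, b i * b j * inner ℝ (x i) (x j) ^ m := by
  have hpsd : (Matrix.of fun i j => inner ℝ (x i) (x j) ^ m :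
      Matrix (Fin n) (Fin n) ℝ).PosSemidef := by
    induction m with
    | zero =>
      have heq : (Matrix.of fun i j => inner ℝ (x i) (x j) ^ 0 : Matrix (Fin n) (Fin n) ℝ) =
          Matrix.gram ℝ (fun _ : Fin n => (1 : ℝ)) := by
        ext i j
        simp [Matrix.gram_apply]
      rw [heq]
      exact Matrix.posSemidef_gram ℝ _
    | succ m ih =>
      exact Matrix.PosSemidef.hadamard ih (Matrix.posSemidef_gram ℝ x)
  have h := hpsd.dotProduct_mulVec_nonneg b
  simp only [dotProduct, Matrix.mulVec, Finset.mul_sum, Matrix.of_apply, Pi.star_apply,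
    star_trivial] at h
  refine h.trans_eq (Finset.sum_congr rfl fun i _ => Finset.sum_congr rfl fun j _ => ?_)
  ring

theorem sum_mul_exp_inner_nonneg {n : ℕ} (x : Fin n → H) (b : Fin n → ℝ) :
    0 ≤ ∑ i, ∑ j, b i * b j * Real.exp (inner ℝ (x i) (x j)) := by
  have h : HasSum (fun m : ℕ => ∑ i, ∑ j, b i * b j * (inner ℝ (x i) (x j) ^ m / m.factorial))
      (∑ i, ∑ j, b i * b j * Real.exp (inner ℝ (x i) (x j))) :=
    hasSum_sum fun i _ => hasSum_sum fun j _ => HasSum.mul_left _ (by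
      rw [Real.exp_eq_exp_ℝ]
      exact NormedSpace.expSeries_div_hasSum_exp _)
  refine h.nonneg fun m => ?_
  have := div_nonneg (sum_mul_inner_pow_nonneg x b m) (Nat.cast_nonneg (α := ℝ) m.factorial)
  refine this.trans_eq ?_
  simp only [Finset.sum_div, mul_div_assoc]

/-- The exponential kernel is strictly positive definite. -/
theorem eq_zero_of_sum_mul_exp_inner_eq_zero {n : ℕ} (x : Fin n → H)
    (hx : Function.Injective x) (b : Fin n → ℝ)
    (h : ∑ i, ∑ j, b i * b j * Real.exp (inner ℝ (x i) (x j)) = 0) (i : Fin n) : b i = 0 := by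
  -- Adjoining `y` with weight `τ` keeps the form nonnegative. As the old form is zero, the term
  -- linear in `τ` must vanish.
  have hker : ∀ y : H, ∑ i, b i * Real.exp (inner ℝ (x i) y) = 0 := by
    intro y
    set B := ∑ i, b i * Real.exp (inner ℝ (x i) y)
    set E := Real.exp (inner ℝ y y)
    have hE : 0 < E := Real.exp_pos _
    have key : ∀ τ : ℝ, 0 ≤ τ * τ * E + 2 * τ * B := by
      intro τ
      have h0 := sum_mul_exp_inner_nonneg (Fin.cons y x : Fin (n + 1) → H)
        (Fin.cons τ b : Fin (n + 1) → ℝ)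
      simp only [Fin.sum_univ_succ, Fin.cons_zero, Fin.cons_succ, Finset.sum_add_distrib, h,
        add_zero] at h0
      have h1 : ∑ j, τ * b j * Real.exp (inner ℝ y (x j)) = τ * B := by
        rw [Finset.mul_sum]
        exact Finset.sum_congr rfl fun j _ => by rw [real_inner_comm]; ring
      have h2 : ∑ j, b j * τ * Real.exp (inner ℝ (x j) y) = τ * B := by
        rw [Finset.mul_sum]
        exact Finset.sum_congr rfl fun j _ => by ring
      rw [h1, h2] at h0
      linarith
    have hB := key (-B / E)
    have : -B / E * (-B / E) * E + 2 * (-B / E) * B = -(B ^ 2 / E) := by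
      field_simp
      ring
    rw [this] at hB
    have hB2 : B ^ 2 / E ≤ 0 := by linarith
    rw [div_le_iff₀ hE, zero_mul] at hB2
    exact pow_eq_zero_iff two_ne_zero |>.1 (le_antisymm hB2 (sq_nonneg B))
  -- The functions $y\mapsto e^{\langle x_i,y\rangle}$ are distinct characters, hence linearly
  -- independent by Dedekind.
  let χ : H → (Multiplicative H →* ℝ) := fun v =>
    { toFun := fun y => Real.exp (inner ℝ v y.toAdd)
      map_one' := by simp
      map_mul' := fun y z => by simp [inner_add_right, Real.exp_add] }
  have hχ : Function.Injective χ := fun v w hvw => by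
    refine ext_inner_right ℝ fun y => ?_
    exact Real.exp_injective (DFunLike.congr_fun hvw (Multiplicative.ofAdd y))
  have hli := (linearIndependent_monoidHom (Multiplicative H) ℝ).comp (fun i => χ (x i))
    (hχ.comp hx)
  refine Fintype.linearIndependent_iff.1 hli b ?_ i
  ext y
  simpa [χ] using hker y.toAdd

theorem sum_mul_exp_neg_norm_sq_eq {n : ℕ} (x : Fin n → H) (a : Fin n → ℝ) {s : ℝ}
    (hs : 0 ≤ s) :
    ∑ i, ∑ j, a i * a j * Real.exp (-(s * ‖x i - x j‖ ^ 2)) =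
      ∑ i, ∑ j, (a i * Real.exp (-(s * ‖x i‖ ^ 2))) * (a j * Real.exp (-(s * ‖x j‖ ^ 2))) *
        Real.exp (inner ℝ (√(2 * s) • x i) (√(2 * s) • x j)) := by
  refine Finset.sum_congr rfl fun i _ => Finset.sum_congr rfl fun j _ => ?_
  have hsq : √(2 * s) * √(2 * s) = 2 * s := Real.mul_self_sqrt (by positivity)
  have : -(s * ‖x i - x j‖ ^ 2) = -(s * ‖x i‖ ^ 2) + -(s * ‖x j‖ ^ 2) +
      inner ℝ (√(2 * s) • x i) (√(2 * s) • x j) := by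
    rw [real_inner_smul_left, real_inner_smul_right, ← mul_assoc, hsq, norm_sub_sq_real]
    ring
  rw [this, Real.exp_add, Real.exp_add]
  ring

/-- The Gaussian kernel is positive semidefinite. -/
theorem sum_mul_exp_neg_norm_sq_nonneg {n : ℕ} (x : Fin n → H) (a : Fin n → ℝ) {s : ℝ}
    (hs : 0 ≤ s) : 0 ≤ ∑ i, ∑ j, a i * a j * Real.exp (-(s * ‖x i - x j‖ ^ 2)) := by
  rw [sum_mul_exp_neg_norm_sq_eq x a hs]
  exact sum_mul_exp_inner_nonneg _ fun i => a i * Real.exp (-(s * ‖x i‖ ^ 2))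

/-- The Gaussian kernel is strictly positive definite. -/
theorem sum_mul_exp_neg_norm_sq_pos {n : ℕ} (x : Fin n → H) (hx : Function.Injective x)
    (a : Fin n → ℝ) (ha : ∃ i, a i ≠ 0) {s : ℝ} (hs : 0 < s) :
    0 < ∑ i, ∑ j, a i * a j * Real.exp (-(s * ‖x i - x j‖ ^ 2)) := by
  refine lt_of_le_of_ne (sum_mul_exp_neg_norm_sq_nonneg x a hs.le) fun h => ?_
  rw [sum_mul_exp_neg_norm_sq_eq x a hs.le] at h
  obtain ⟨i, hi⟩ := ha
  have hs' : √(2 * s) ≠ 0 := (Real.sqrt_pos.2 (by positivity)).ne'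
  have := eq_zero_of_sum_mul_exp_inner_eq_zero (fun i => √(2 * s) • x i)
    ((smul_right_injective H hs').comp hx) (fun i => a i * Real.exp (-(s * ‖x i‖ ^ 2))) h.symm i
  exact hi ((mul_eq_zero.1 this).resolve_right (Real.exp_pos _).ne')

end Gaussian

/-! ### Strict positive definiteness -/

/-- A difference of two decaying exponentials is dominated by any function that is continuous and
positive at positive rates, up to an arbitrarily small constant. -/
theorem exists_abs_exp_sub_exp_le {p q : ℝ} (hp : 0 < p) (hq : 0 < q) {Q : ℝ → ℝ}
    (hQc : Continuous Q) (hQ0 : ∀ s, 0 ≤ s → 0 ≤ Q s) (hQ : ∀ s, 0 < s → 0 < Q s)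
    {δ : ℝ} (hδ : 0 < δ) :
    ∃ K : ℝ, ∀ s, 0 ≤ s → |Real.exp (-(s * p)) - Real.exp (-(s * q))| ≤ δ + K * Q s := by
  set g : ℝ → ℝ := fun s => |Real.exp (-(s * p)) - Real.exp (-(s * q))| with hg
  have hgc : Continuous g := by fun_prop
  have h0 : ∀ᶠ s in 𝓝 (0 : ℝ), g s < δ :=
    hgc.continuousAt.eventually_lt continuousAt_const (by simpa [hg] using hδ)
  have hexp : ∀ r : ℝ, 0 < r → Tendsto (fun s : ℝ => Real.exp (-(s * r))) atTop (𝓝 0) :=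
    fun r hr => Real.tendsto_exp_neg_atTop_nhds_zero.comp (tendsto_id.atTop_mul_const hr)
  have htop : Tendsto g atTop (𝓝 0) := by
    simpa using ((hexp p hp).sub (hexp q hq)).abs
  obtain ⟨a, ha, hga⟩ := Metric.eventually_nhds_iff.1 h0
  obtain ⟨b, hgb⟩ := eventually_atTop.1 (htop.eventually_lt_const hδ)
  -- Near zero and infinity `δ` suffices; between them `Q` has a positive lower bound and the
  -- difference is at most 1.
  obtain ⟨m, hm, hmQ⟩ := isCompact_Icc.exists_forall_le' (s := Set.Icc a b) hQc.continuousOn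
    (a := 0) fun s hs => hQ s (ha.trans_le hs.1)
  refine ⟨m⁻¹, fun s hs => ?_⟩
  have hKQ : 0 ≤ m⁻¹ * Q s := mul_nonneg (by positivity) (hQ0 s hs)
  rcases lt_or_ge s a with hsa | hsa
  · have := hga (y := s) (by simpa [abs_of_nonneg hs] using hsa)
    exact this.le.trans (by linarith)
  rcases le_or_gt b s with hsb | hsb
  · exact (hgb s hsb).le.trans (by linarith)
  · have h1 : 1 ≤ m⁻¹ * Q s := by
      rw [← div_eq_inv_mul, one_le_div hm]
      exact hmQ s ⟨hsa, hsb.le⟩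
    have hle : ∀ r : ℝ, 0 < r → Real.exp (-(s * r)) ≤ 1 := fun r hr =>
      Real.exp_le_one_iff.2 (neg_nonpos.2 (by positivity))
    have h2 : |Real.exp (-(s * p)) - Real.exp (-(s * q))| ≤ 1 := by
      rw [abs_le]
      constructor <;> linarith [hle p hp, hle q hq, Real.exp_pos (-(s * p)),
        Real.exp_pos (-(s * q))]
    linarith

/-- A completely monotone function that is not constant on `[0, ∞)` is not constant on
`(0, ∞)`. -/
theorem IsCompletelyMonotone.exists_pos_ne {ψ : ℝ → ℝ} (hψ : IsCompletelyMonotone ψ)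
    (h : ∃ s t : ℝ, 0 ≤ s ∧ 0 ≤ t ∧ ψ s ≠ ψ t) : ∃ p q : ℝ, 0 < p ∧ 0 < q ∧ ψ p ≠ ψ q := by
  by_contra! hc
  obtain ⟨s, t, hs, ht, hst⟩ := h
  have hlim : ∀ r : ℝ, 0 ≤ r → ψ r = ψ 1 := fun r hr => by
    have h1 : Tendsto ψ (𝓝[>] r) (𝓝 (ψ r)) :=
      (hψ.continuousOn r hr).mono_left (nhdsWithin_mono r fun y hy => hr.trans (le_of_lt hy))
    refine tendsto_nhds_unique h1 (tendsto_const_nhds.congr' ?_)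
    filter_upwards [self_mem_nhdsWithin] with y hy
    exact hc 1 y one_pos (hr.trans_lt hy)
  exact hst ((hlim s hs).trans (hlim t ht).symm)

section Embedding

variable {X H : Type*} [NormedAddCommGroup H] [InnerProductSpace ℝ H]

theorem IsCompletelyMonotone.isPosSemidefFun {ψ : ℝ → ℝ} (hψ : IsCompletelyMonotone ψ)
    (ξ : X → H) : IsPosSemidefFun fun x y => ψ (‖ξ x - ξ y‖ ^ 2) := by
  intro n x a
  have := hψ.sum_nonneg (fun k : Fin n × Fin n => a k.1 * a k.2)
    (fun k => ‖ξ (x k.1) - ξ (x k.2)‖ ^ 2) (fun k => by positivity) fun s hs => by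
      rw [Fintype.sum_prod_type]
      exact sum_mul_exp_neg_norm_sq_nonneg (fun i => ξ (x i)) a hs
  rwa [Fintype.sum_prod_type] at this

theorem IsCompletelyMonotone.isStrictPosDefFun {ψ : ℝ → ℝ} (hψ : IsCompletelyMonotone ψ)
    (hne : ∃ s t : ℝ, 0 ≤ s ∧ 0 ≤ t ∧ ψ s ≠ ψ t) (ξ : X → H) (hξ : Function.Injective ξ) :
    IsStrictPosDefFun fun x y => ψ (‖ξ x - ξ y‖ ^ 2) := by
  refine ⟨hψ.isPosSemidefFun ξ, fun n x hx a h => ?_⟩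
  by_contra! ha
  obtain ⟨p, q, hp, hq, hpq⟩ := hψ.exists_pos_ne hne
  set Q : ℝ → ℝ := fun s => ∑ i, ∑ j, a i * a j * Real.exp (-(s * ‖ξ (x i) - ξ (x j)‖ ^ 2))
  have hQc : Continuous Q := by fun_prop
  have hQ0 : ∀ s, 0 ≤ s → 0 ≤ Q s := fun s hs =>
    sum_mul_exp_neg_norm_sq_nonneg (fun i => ξ (x i)) a hs
  have hQ : ∀ s, 0 < s → 0 < Q s := fun s hs =>
    sum_mul_exp_neg_norm_sq_pos (fun i => ξ (x i)) (hξ.comp hx) a ha hs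
  have hbound : ∀ δ > 0, ∀ ε : ℝ, |ε| = 1 → ε * (ψ p - ψ q) ≤ δ * ψ 0 := by
    intro δ hδ ε hε
    obtain ⟨K, hK⟩ := exists_abs_exp_sub_exp_le hp hq hQc hQ0 hQ hδ
    -- Transfer of $\delta-\varepsilon(e^{-sp}-e^{-sq})+KQ(s)\ge 0$, the constant `δ` being an
    -- exponential with $t=0$.
    have key := hψ.sum_nonneg
      (Sum.elim (fun k : Fin n × Fin n => K * (a k.1 * a k.2)) ![δ, -ε, ε])
      (Sum.elim (fun k => ‖ξ (x k.1) - ξ (x k.2)‖ ^ 2) ![0, p, q])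
      (by
        rintro (k | k)
        · simp only [Sum.elim_inl]; positivity
        · fin_cases k <;> simp [hp.le, hq.le])
      (fun s hs => by
        have h1 : ε * (Real.exp (-(s * p)) - Real.exp (-(s * q))) ≤ δ + K * Q s := by
          refine (le_abs_self _).trans ?_
          rw [abs_mul, hε, one_mul]
          exact hK s hs
        simp only [Q, Finset.mul_sum] at h1
        simp only [Fintype.sum_sum_type, Fintype.sum_prod_type, Fin.sum_univ_three, Sum.elim_inl,
          Sum.elim_inr, Matrix.cons_val, mul_zero, neg_zero, Real.exp_zero, mul_one, mul_assoc]
          at h1 ⊢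
        linarith)
    simp only [Fintype.sum_sum_type, Fintype.sum_prod_type, Fin.sum_univ_three, Sum.elim_inl,
      Sum.elim_inr, Matrix.cons_val, mul_assoc, ← Finset.mul_sum] at key
    simp only [mul_assoc, ← Finset.mul_sum] at h
    rw [h] at key
    linarith
  have hzero : ∀ ε : ℝ, |ε| = 1 → ε * (ψ p - ψ q) ≤ 0 := fun ε hε => by
    have hlim : Tendsto (fun δ : ℝ => δ * ψ 0) (𝓝[>] 0) (𝓝 0) := by
      have : Tendsto (fun δ : ℝ => δ * ψ 0) (𝓝 0) (𝓝 (0 * ψ 0)) := tendsto_id.mul_const _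
      rw [zero_mul] at this
      exact this.mono_left nhdsWithin_le_nhds
    refine ge_of_tendsto hlim ?_
    filter_upwards [self_mem_nhdsWithin] with δ hδ using hbound δ hδ ε hε
  have h1 := hzero 1 (by simp)
  have h2 := hzero (-1) (by simp)
  exact hpq (by linarith)

end Embedding

/-! ### The variogram in $L^2$ -/

/-- The centred process embeds the variogram isometrically into `L²`. -/
theorem exists_variogram_eq_norm_sq {X : Type u} {Ω : Type v} [MeasurableSpace Ω] (P : Measure Ω)
    [IsProbabilityMeasure P] (Z : X → Ω → ℝ) (hZ : ∀ x, MemLp (Z x) 2 P) :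
    ∃ ξ : X → Lp ℝ 2 P, ∀ x y, variogram P Z x y = ‖ξ x - ξ y‖ ^ 2 := by
  have hc : ∀ x, MemLp (fun ω => Z x ω - ∫ ω, Z x ω ∂P) 2 P := fun x =>
    (hZ x).sub (memLp_const _)
  refine ⟨fun x => (hc x).toLp _, fun x y => ?_⟩
  rw [variogram, variance_eq_integral ((hZ x).aemeasurable.fun_sub (hZ y).aemeasurable),
    integral_sub ((hZ x).integrable one_le_two) ((hZ y).integrable one_le_two),
    ← MemLp.toLp_sub, ← real_inner_self_eq_norm_sq, L2.inner_def]
  refine integral_congr_ae ?_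
  filter_upwards [MemLp.coeFn_toLp ((hc x).sub (hc y))] with ω hω
  rw [hω]
  simp only [Pi.sub_apply, RCLike.inner_apply, conj_trivial]
  ring

theorem theoremB1 {X : Type u} {Ω : Type v} [MeasurableSpace Ω] (P : Measure Ω)
    [IsProbabilityMeasure P] (Z : X → Ω → ℝ) (hZ : ∀ x, MemLp (Z x) 2 P) :
    (∃ (H : Type v) (_ : NormedAddCommGroup H) (_ : InnerProductSpace ℝ H) (_ : CompleteSpace H),
      HasEmbedding Real.sqrt (variogram P Z) H) ∧
    ∀ ψ : ℝ → ℝ, IsCompletelyMonotone ψ →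
      (∃ s t : ℝ, 0 ≤ s ∧ 0 ≤ t ∧ ψ s ≠ ψ t) →
      IsPosSemidefFun (fun x₁ x₂ => ψ (variogram P Z x₁ x₂)) ∧
      (IsSemiMetric (variogram P Z) →
        IsStrictPosDefFun (fun x₁ x₂ => ψ (variogram P Z x₁ x₂))) := by
  obtain ⟨ξ, hξ⟩ := exists_variogram_eq_norm_sq P Z hZ
  refine ⟨⟨Lp ℝ 2 P, inferInstance, inferInstance, inferInstance, ξ, fun x y => ?_⟩,
    fun ψ hψ hne => ⟨?_, fun hd => ?_⟩⟩
  · rw [hξ, Real.sqrt_sq (norm_nonneg _)]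
  · simp only [hξ]
    exact hψ.isPosSemidefFun ξ
  · have hinj : Function.Injective ξ := fun x y hxy =>
      (hd.eq_zero_iff x y).1 (by rw [hξ, hxy]; simp)
    simp only [hξ]
    exact hψ.isStrictPosDefFun hne ξ hinj
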